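/- Let $p$ be a prime and let $G$ be a finite group with a split $BN$-pair $(B,N)$ of characteristic $p$ (for example, a finite group of Lie type defined in characteristic $p$): $(B,N)$ is a $BN$-pair, $T=B\cap N$ is an abelian group of order prime to $p$, $B=UT$ where $U=O_p(B)$ is the largest normal $p$-subgroup of $B$, and $\bigcap_{n\in N} nBn^{-1}=T$. Let $k$ be an algebraically closed field of characteristic $r>0$ with $r\neq p$. For a $kT$-module $X$ let $R_T^G(X)=\mathrm{Ind}_B^G(\tilde X)$, where $\tilde X$ is the inflation of $X$ along the projection $B\to T$ with kernel $U$. More generally, for a parabolic subgroup $P$ (an $N$-conjugate of a standard parabolic subgroup) with largest normal $p$-subgroup $U_P$ and Levi complement $L$ (an $N$-conjugate of a standard Levi subgroup, with $P=U_P\rtimes L$), let ${}^*R_L^G(Y)=Y^{U_P}$, a $kL$-module, for every $kG$-module $Y$; in particular ${}^*R_T^G(Y)=Y^U$. For an irreducible $kT$-module $X$, the principal series $\mathrm{Irr}_k(G|(T,X))$ is the set of (isomorphism classes of) irreducible $kG$-modules $Y$ such that $T$ is minimal among the Levi subgroups $L$ with ${}^*R_L^G(Y)\neq 0$ and $X$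 is a composition factor of the $kT$-module ${}^*R_T^G(Y)$. Let $X$ and $X'$ be irreducible $kT$-modules, let $Y\in \mathrm{Irr}_k(G|(T,X))$ and $V\in \mathrm{Irr}_k(G|(T,X'))$, and suppose that $\mathrm{Irr}_k(G|(T,X))\neq \mathrm{Irr}_k(G|(T,X'))$. Then $[R_T^G(X):V]=0$, i.e. $V$ does not occur as a composition factor of $R_T^G(X)$. -/

import Mathlib

open scoped Pointwise MonoidAlgebra

universe w u v

namespace HarishChandra

/-- The largest normal `p`-subgroup `O_p(G)` of a group. -/
def pCore (p : ℕ) (G : Type*) [Group G] : Subgroup G :=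
  sSup {H : Subgroup G | H.Normal ∧ IsPGroup p H}

instance pCore_normal (p : ℕ) (G : Type*) [Group G] : (pCore p G).Normal :=
  Subgroup.sSup_normal _ fun _ h => h.1

theorem pCore_isPGroup (p : ℕ) [Fact p.Prime] (G : Type*) [Group G] [Finite G] :
    IsPGroup p (pCore p G) := by
  obtain ⟨P⟩ : Nonempty (Sylow p G) := inferInstance
  refine P.isPGroup'.to_le (sSup_le ?_)
  rintro H ⟨hn, hp⟩
  have h : IsPGroup p (H ⊔ (P : Subgroup G) : Subgroup G) :=
    hp.to_sup_of_normal_left P.isPGroup'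
  exact le_sup_left.trans (P.is_maximal' h le_sup_right).le

/-- A `BN`-pair `(B, N)` in a group `G`, with `T = B ∩ N`, `W = N / T` and `S` the
distinguished set of involutions generating `W`. -/
structure BNPair (G : Type*) [Group G] where
  /-- The Borel subgroup. -/
  B : Subgroup G
  N : Subgroup G
  /-- `G` is generated by `B` and `N`. -/
  generate : B ⊔ N = ⊤
  /-- `T = B ∩ N` is normal in `N`. -/
  [normal : ((B ⊓ N).subgroupOf N).Normal]
  /-- The distinguished generators of `W = N / T`. -/
  S : Set (N ⧸ (B ⊓ N).subgroupOf N)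
  closure_S : Subgroup.closure S = ⊤
  sq_eq_one : ∀ s ∈ S, s * s = 1
  conj_ne : ∀ n : N, (n : N ⧸ (B ⊓ N).subgroupOf N) ∈ S → MulAut.conj (n : G) • B ≠ B
  /-- `nBm ⊆ BnmB ∪ BmB` for `n` representing an element of `S` and `m ∈ N`. -/
  exchange : ∀ n m : N, (n : N ⧸ (B ⊓ N).subgroupOf N) ∈ S → ∀ b ∈ B,
    (n : G) * b * m ∈
      DoubleCoset.doubleCoset ((n : G) * m) B B ∪ DoubleCoset.doubleCoset (m : G) B B

attribute [instance] BNPair.normal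

/-- A split `BN`-pair of characteristic `p`: `B = UT` with `U = O_p(B)` and `T = B ∩ N` an
abelian `p'`-group, and the intersection of all the `N`-conjugates of `B` is `T`. -/
structure SplitBNPair (p : ℕ) (G : Type*) [Group G] extends BNPair G where
  split : (pCore p B).map B.subtype ⊔ (B ⊓ N) = B
  comm : ∀ s ∈ B ⊓ N, ∀ t ∈ B ⊓ N, s * t = t * s
  coprime : (Nat.card (B ⊓ N : Subgroup G)).Coprime p
  iInf_conj : ⨅ n : N, MulAut.conj (n : G) • B = B ⊓ N

namespace BNPair

variable {G : Type*} [Group G] (D : BNPair G)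

/-- The torus `T = B ∩ N`. -/
abbrev T : Subgroup G := D.B ⊓ D.N

/-- The Weyl group `W = N / T`. -/
abbrev W : Type _ := D.N ⧸ D.T.subgroupOf D.N

/-- The preimage `N_J` in `N` of the parabolic subgroup `W_J = ⟨J⟩` of `W`. -/
def NJ (J : Set D.W) : Subgroup G :=
  ((Subgroup.closure J).comap (QuotientGroup.mk' (D.T.subgroupOf D.N))).map D.N.subtype

/-- The standard parabolic subgroup `P_J = B N_J B`, the subgroup generated by `B` and `N_J`. -/
def standardParabolic (J : Set D.W) : Subgroup G := D.B ⊔ D.NJ J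

/-- `L` is the standard Levi subgroup `L_J`: the intersection of `P_J` with the opposite parabolic
subgroup, generated by `N_J` and the opposite Borel subgroup. The latter is the conjugate of `B` by
the longest element of `W`, that is, the `N`-conjugate of `B` meeting `B` exactly in `T`. -/
def IsStandardLevi (J : Set D.W) (L : Subgroup G) : Prop :=
  ∃ n ∈ D.N, D.B ⊓ MulAut.conj n • D.B = D.T ∧
    L = D.standardParabolic J ⊓ (MulAut.conj n • D.B ⊔ D.NJ J)

/-- Membership in `𝒫_G`, the set of `N`-conjugates of standard parabolic subgroups. -/
def IsParabolic (P : Subgroup G) : Prop :=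
  ∃ J ⊆ D.S, ∃ n ∈ D.N, P = MulAut.conj n • D.standardParabolic J

/-- Membership in `ℒ_G`, the set of `N`-conjugates of standard Levi subgroups. -/
def IsLevi (L : Subgroup G) : Prop :=
  ∃ J ⊆ D.S, ∃ L₀, D.IsStandardLevi J L₀ ∧ ∃ n ∈ D.N, L = MulAut.conj n • L₀

end BNPair

/-- `L` is a Levi complement in `P`, i.e. `P = U_P ⋊ L` with `U_P = O_p(P)`. -/
structure IsLeviComplement (p : ℕ) {G : Type*} [Group G] (P L : Subgroup G) : Prop where
  le : L ≤ P
  compl : (L.subgroupOf P).IsComplement' (pCore p P)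

/-- The projection `P → L` with kernel `U_P`. -/
noncomputable def leviProj {p : ℕ} {G : Type*} [Group G] {P L : Subgroup G}
    (h : IsLeviComplement p P L) : P →* L :=
  (Subgroup.subgroupOfEquivOfLe h.le).toMonoidHom.comp
    (h.compl.QuotientMulEquiv.toMonoidHom.comp (QuotientGroup.mk' (pCore p P)))

/-- The torus `T` is a Levi complement in `B`. -/
theorem SplitBNPair.isLeviComplement {p : ℕ} [Fact p.Prime] {G : Type*} [Group G] [Finite G]
    (D : SplitBNPair p G) : IsLeviComplement p D.B D.T := by
  refine ⟨inf_le_left, Subgroup.isComplement'_of_disjoint_and_mul_eq_univ ?_ ?_⟩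
  · refine Subgroup.disjoint_of_coprime_natCard ?_
    obtain ⟨n, hn⟩ := IsPGroup.iff_card.1 (pCore_isPGroup p D.B)
    rw [hn, Nat.card_congr (Subgroup.subgroupOfEquivOfLe (inf_le_left : D.T ≤ D.B)).toEquiv]
    exact D.coprime.pow_right n
  · rw [← Subgroup.mul_normal]
    have h : D.T.subgroupOf D.B ⊔ pCore p D.B = ⊤ := by
      apply Subgroup.map_injective D.B.subtype_injective
      rw [Subgroup.map_sup, Subgroup.subgroupOf_map_subtype, ← MonoidHom.range_eq_map,
        Subgroup.range_subtype, sup_comm, inf_eq_left.2 (inf_le_left : D.T ≤ D.B)]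
      exact D.split
    rw [h]; rfl

section Modules

variable {k : Type u} [Field k] {G : Type v} [Group G]

/-- The Harish-Chandra induction `R_{L ⊆ P}^G(X)`: inflate `X` from `L` to `P`, then induce
to `G`. -/
noncomputable def hcInd {p : ℕ} {P L : Subgroup G} (h : IsLeviComplement p P L)
    {X : Type*} [AddCommGroup X] [Module k X] (τ : Representation k L X) :
    Representation k G (Representation.IndV P.subtype (τ.comp (leviProj h))) :=
  Representation.ind P.subtype (τ.comp (leviProj h))

/-- The Harish-Chandra restriction `*R_{L ⊆ P}^G(Y)`: the space `Y^{U_P}` with the action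
of `L`. -/
noncomputable def hcRes {p : ℕ} {P L : Subgroup G} (h : IsLeviComplement p P L)
    {Y : Type*} [AddCommGroup Y] [Module k Y] (ρ : Representation k G Y) :
    Representation k L
      (Representation.invariants
        ((ρ.comp P.subtype : Representation k P Y).comp (pCore p P).subtype)) :=
  (Representation.toInvariants (ρ.comp P.subtype : Representation k P Y) (pCore p P)).comp
    (Subgroup.inclusion h.le)

/-- The multiplicity `[M : V]` of `V` as a composition factor of `M`: the number of factors
isomorphic to `V` in a composition series of `M` (by Jordan-Hölder, all of them give the same
number, so that the supremum over all composition series is that number). -/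
noncomputable def compositionMultiplicity {M V : Type*} [AddCommGroup M] [Module k M]
    [AddCommGroup V] [Module k V] (ρ : Representation k G M) (σ : Representation k G V) : ℕ∞ :=
  ⨆ s : {s : CompositionSeries (Submodule k[G] ρ.asModule) // s.head = ⊥ ∧ s.last = ⊤},
    Set.encard {i : Fin s.1.length | Nonempty
      ((s.1 i.succ ⧸ (s.1 i.castSucc).comap (s.1 i.succ).subtype) ≃ₗ[k[G]] σ.asModule)}

/-- The Harish-Chandra series `Irr_k(G|(L,X))`: the irreducible `kG`-modules `Y` such that `L` is
minimal in `ℒ_G` with `*R_L^G(Y) ≠ 0` and `X` is a composition factor of `*R_L^G(Y)`, where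
`*R_L^G` is computed in the parabolic subgroup `P` with Levi complement `L`. It is used for an
irreducible cuspidal `kL`-module `X`, and it is represented as an isomorphism-closed collection of
modules. -/
def hcSeries (D : BNPair G) {p : ℕ} {P L : Subgroup G} (h : IsLeviComplement p P L)
    {X : Type*} [AddCommGroup X] [Module k X] (τ : Representation k L X) : Set (Rep.{w} k G) :=
  {Y | Y.ρ.IsIrreducible ∧
    Nontrivial (Representation.invariants
      ((Y.ρ.comp P.subtype : Representation k P Y.V).comp (pCore p P).subtype)) ∧
    (∀ P' L' : Subgroup G, D.IsParabolic P' → D.IsLevi L' → IsLeviComplement p P' L' → L' < L →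
      Subsingleton (Representation.invariants
        ((Y.ρ.comp P'.subtype : Representation k P' Y.V).comp (pCore p P').subtype))) ∧
    compositionMultiplicity (hcRes h Y.ρ) τ ≠ 0}

/-- The principal series `Irr_k(G|(T,X))`. Every `kT`-module is cuspidal. -/
noncomputable def principalSeries {p : ℕ} [Fact p.Prime] [Finite G] (D : SplitBNPair p G)
    {X : Type*} [AddCommGroup X] [Module k X] (τ : Representation k D.T X) : Set (Rep.{w} k G) :=
  hcSeries D.toBNPair D.isLeviComplement τ

end Modules

end HarishChandra

/-!
For a `kG`-module `M` let `J_M ≤ kT` be the annihilator of `M^U`. The element `e = ∑_{u ∈ U} u`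
maps `M` onto `M^U`, since `|U|` is invertible in `k`; hence `a ∈ J_M` if and only if `a e`
annihilates `M`, and `J_M ≤ J_V` for every composition factor `V` of `M`. As `kT` is commutative
and `V^U` is finite-dimensional, an irreducible `kT`-module is a composition factor of `V^U` if
and only if its annihilator, a maximal ideal of `kT`, contains `J_V`.

The ideal `J_M` is stable under conjugation by `N`: if `n ∈ N` represents a distinguished
generator of `W`, then a nonzero vector `y` of `M^U` satisfies `e n⁻¹ y ≠ 0`, because otherwise
`e n e n⁻¹ y` would be a nonzero multiple of `y`. By the Bruhat decomposition, `J_M` contains the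
intersection of the `N`-conjugates of the annihilator of `X` when `M = R_T^G(X)`. So if `V` is a
composition factor of `R_T^G(X)` that lies in the principal series of `X'`, then the annihilator
of `X'` contains one of these finitely many maximal ideals, and is equal to it. As each `J_Y` is
stable under `N`, the two principal series coincide.
-/

namespace HarishChandra

section CompositionFactors

variable {A M X : Type*} [AddCommGroup M] [AddCommGroup X]

theorem annihilator_le_of_factor_equiv [Ring A] [Module A M] [Module A X] {N₁ N₂ : Submodule A M}
    (e : (N₂ ⧸ N₁.comap N₂.subtype) ≃ₗ[A] X) : Module.annihilator A M ≤ Module.annihilator A X :=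
  calc Module.annihilator A M
    _ ≤ Module.annihilator A N₂ := N₂.subtype.annihilator_le_of_injective N₂.subtype_injective
    _ ≤ Module.annihilator A (N₂ ⧸ N₁.comap N₂.subtype) :=
      LinearMap.annihilator_le_of_surjective _ (Submodule.mkQ_surjective _)
    _ = Module.annihilator A X := e.annihilator_eq

variable [CommRing A] [Module A M] [Module A X]

theorem nonempty_linearEquiv_quotient_annihilator [IsSimpleModule A X] :
    Nonempty (X ≃ₗ[A] A ⧸ Module.annihilator A X) := by
  obtain ⟨I, -, ⟨e⟩⟩ := isSimpleModule_iff_quot_maximal.1 ‹IsSimpleModule A X›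
  rw [e.annihilator_eq, Ideal.annihilator_quotient]
  exact ⟨e⟩

theorem isMaximal_annihilator [IsSimpleModule A X] : (Module.annihilator A X).IsMaximal := by
  obtain ⟨I, hI, ⟨e⟩⟩ := isSimpleModule_iff_quot_maximal.1 ‹IsSimpleModule A X›
  rwa [e.annihilator_eq, Ideal.annihilator_quotient]

theorem nonempty_linearEquiv_of_annihilator_le {X' : Type*} [AddCommGroup X'] [Module A X']
    [IsSimpleModule A X] [IsSimpleModule A X']
    (h : Module.annihilator A X ≤ Module.annihilator A X') : Nonempty (X ≃ₗ[A] X') := by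
  obtain ⟨e⟩ := nonempty_linearEquiv_quotient_annihilator (A := A) (X := X)
  obtain ⟨e'⟩ := nonempty_linearEquiv_quotient_annihilator (A := A) (X := X')
  have hXX' : Module.annihilator A X = Module.annihilator A X' :=
    isMaximal_annihilator.eq_of_le isMaximal_annihilator.ne_top h
  exact ⟨(e.trans (Submodule.quotEquivOfEq _ _ hXX')).trans e'.symm⟩

theorem exists_factor_equiv_of_annihilator_le [IsSimpleModule A X]
    (s : CompositionSeries (Submodule A M)) (hbot : s.head = ⊥) (htop : s.last = ⊤)
    (h : Module.annihilator A M ≤ Module.annihilator A X) :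
    ∃ i : Fin s.length,
      Nonempty ((s i.succ ⧸ (s i.castSucc).comap (s i.succ).subtype) ≃ₗ[A] X) := by
  have hmax : (Module.annihilator A X).IsMaximal := isMaximal_annihilator
  -- `X` is the first factor at which the decreasing annihilators enter the maximal ideal of `X`.
  obtain ⟨i, hi, hi'⟩ : ∃ i : Fin s.length, ¬ (s i.castSucc).annihilator ≤ Module.annihilator A X ∧
      (s i.succ).annihilator ≤ Module.annihilator A X := by
    by_contra! hstep
    have hall (i) : ¬ (s i).annihilator ≤ Module.annihilator A X := by
      induction i using Fin.induction with
      | zero =>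
        change ¬ s.head.annihilator ≤ _
        rw [hbot, Submodule.annihilator_bot, top_le_iff]
        exact hmax.ne_top
      | succ i ih => exact hstep i ih
    refine hall (Fin.last _) ?_
    change s.last.annihilator ≤ _
    rwa [htop, Submodule.annihilator_top]
  have := (covBy_iff_quot_is_simple (s.step i).le).1 (s.step i)
  refine ⟨i, nonempty_linearEquiv_of_annihilator_le fun c hc => ?_⟩
  obtain ⟨b, hb, hbX⟩ := SetLike.not_le_iff_exists.1 hi
  suffices hbc : b * c ∈ (s i.succ).annihilator from
    (hmax.isPrime.mem_or_mem (hi' hbc)).resolve_left hbX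
  rw [Submodule.mem_annihilator] at hb ⊢
  intro x hx
  rw [mul_smul]
  refine hb _ ?_
  have hcx := Module.mem_annihilator.1 hc (Submodule.Quotient.mk ⟨x, hx⟩)
  rwa [← Submodule.Quotient.mk_smul, Submodule.Quotient.mk_eq_zero] at hcx

end CompositionFactors

section CompositionMultiplicity

theorem annihilator_asModule {k : Type*} [CommRing k] {H : Type*} [Group H] {M : Type*}
    [AddCommGroup M] [Module k M] (ρ : Representation k H M) :
    Module.annihilator k[H] ρ.asModule = RingHom.ker ρ.asAlgebraHom := by
  ext a
  exact Module.mem_annihilator.trans (LinearMap.ext_iff (f := ρ.asAlgebraHom a) (g := 0)).symm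

variable {k : Type*} [Field k] {H : Type*} [Group H]
  {M V : Type*} [AddCommGroup M] [Module k M] [AddCommGroup V] [Module k V]
  {ρ : Representation k H M} {σ : Representation k H V}

theorem compositionMultiplicity_ne_zero_iff : compositionMultiplicity ρ σ ≠ 0 ↔
    ∃ s : CompositionSeries (Submodule k[H] ρ.asModule), (s.head = ⊥ ∧ s.last = ⊤) ∧
      ∃ i : Fin s.length, Nonempty
        ((s i.succ ⧸ (s i.castSucc).comap (s i.succ).subtype) ≃ₗ[k[H]] σ.asModule) := by
  simp only [compositionMultiplicity, ne_eq, ENat.iSup_eq_zero, not_forall, Set.encard_eq_zero,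
    ← Set.nonempty_iff_ne_empty]
  exact ⟨fun ⟨⟨s, hs⟩, i, e⟩ => ⟨s, hs, i, e⟩, fun ⟨s, hs, i, e⟩ => ⟨⟨s, hs⟩, i, e⟩⟩

theorem ker_asAlgebraHom_le_of_compositionMultiplicity_ne_zero
    (h : compositionMultiplicity ρ σ ≠ 0) :
    RingHom.ker ρ.asAlgebraHom ≤ RingHom.ker σ.asAlgebraHom := by
  obtain ⟨_, _, _, ⟨e⟩⟩ := compositionMultiplicity_ne_zero_iff.1 h
  rw [← annihilator_asModule, ← annihilator_asModule]
  exact annihilator_le_of_factor_equiv e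

theorem finiteDimensional_of_isIrreducible [Finite H] (hσ : σ.IsIrreducible) :
    FiniteDimensional k V := by
  have : IsSimpleModule k[H] σ.asModule :=
    (Representation.irreducible_iff_isSimpleModule_asModule σ).1 hσ
  have : Module.Finite k σ.asModule := Module.Finite.trans k[H] σ.asModule
  exact Module.Finite.equiv σ.asModuleEquiv

open scoped IsMulCommutative in
theorem isMaximal_ker_asAlgebraHom [IsMulCommutative H] (hσ : σ.IsIrreducible) :
    (RingHom.ker σ.asAlgebraHom).IsMaximal := by
  have : IsSimpleModule k[H] σ.asModule :=
    (Representation.irreducible_iff_isSimpleModule_asModule σ).1 hσ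
  exact annihilator_asModule σ ▸ isMaximal_annihilator

open scoped IsMulCommutative in
theorem compositionMultiplicity_ne_zero_iff_ker_le [IsMulCommutative H] [FiniteDimensional k M]
    (hσ : σ.IsIrreducible) : compositionMultiplicity ρ σ ≠ 0 ↔
      RingHom.ker ρ.asAlgebraHom ≤ RingHom.ker σ.asAlgebraHom := by
  refine ⟨ker_asAlgebraHom_le_of_compositionMultiplicity_ne_zero, fun h => ?_⟩
  have : IsSimpleModule k[H] σ.asModule :=
    (Representation.irreducible_iff_isSimpleModule_asModule σ).1 hσ
  have : IsNoetherian k[H] ρ.asModule := isNoetherian_of_tower k inferInstance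
  have : IsArtinian k[H] ρ.asModule := isArtinian_of_tower k inferInstance
  obtain ⟨s, hbot, htop⟩ := exists_compositionSeries_of_isNoetherian_isArtinian k[H] ρ.asModule
  rw [← annihilator_asModule, ← annihilator_asModule] at h
  exact compositionMultiplicity_ne_zero_iff.2
    ⟨s, ⟨hbot, htop⟩, exists_factor_equiv_of_annihilator_le s hbot htop h⟩

end CompositionMultiplicity

section SubgroupSum

variable {k : Type*} [CommRing k] {G : Type*} [Group G]

/-- The inclusion `kH → kG` of the group algebra of a subgroup `H ≤ G`. -/
noncomputable abbrev subgroupAlgHom (k : Type*) [CommRing k] (H : Subgroup G) : k[H] →ₐ[k] k[G] :=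
  MonoidAlgebra.mapDomainAlgHom k k H.subtype

/-- The sum in `kG` of the elements of a finite subgroup `H ≤ G`: up to the factor `|H|`, it is the
idempotent that projects onto the `H`-invariants. It is `0` if `H` is infinite. -/
noncomputable def subgroupSum (k : Type*) [CommRing k] (H : Subgroup G) : k[G] :=
  ∑ᶠ h : H, MonoidAlgebra.of k G h

variable {H : Subgroup G}

theorem subgroupAlgHom_of (h : H) :
    subgroupAlgHom k H (MonoidAlgebra.of k H h) = MonoidAlgebra.of k G h := by
  simp

variable [Finite H]

theorem of_mul_subgroupSum {h : G} (hh : h ∈ H) :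
    MonoidAlgebra.of k G h * subgroupSum k H = subgroupSum k H := by
  rw [subgroupSum, mul_finsum' _ _ (Set.toFinite _)]
  simp only [← map_mul]
  exact finsum_comp_equiv (f := fun x : H => MonoidAlgebra.of k G x) (Equiv.mulLeft ⟨h, hh⟩)

theorem subgroupSum_mul_of {h : G} (hh : h ∈ H) :
    subgroupSum k H * MonoidAlgebra.of k G h = subgroupSum k H := by
  rw [subgroupSum, finsum_mul' _ _ (Set.toFinite _)]
  simp only [← map_mul]
  exact finsum_comp_equiv (f := fun x : H => MonoidAlgebra.of k G x) (Equiv.mulRight ⟨h, hh⟩)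

theorem commute_of_subgroupSum {g : G} (hg : g ∈ Subgroup.normalizer (H : Set G)) :
    Commute (MonoidAlgebra.of k G g) (subgroupSum k H) := by
  rw [commute_iff_eq, subgroupSum, mul_finsum' _ _ (Set.toFinite _),
    finsum_mul' _ _ (Set.toFinite _)]
  simp only [← map_mul]
  refine (finsum_congr fun h => ?_).trans
    (finsum_comp_equiv (H.normalizerMonoidHom ⟨g, hg⟩).toEquiv)
  exact congrArg (MonoidAlgebra.of k G) (inv_mul_cancel_right (g * h) g).symm

variable {M : Type*} [AddCommGroup M] [Module k M] {ρ : Representation k G M}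

theorem asAlgebraHom_subgroupSum_apply (y : M) :
    ρ.asAlgebraHom (subgroupSum k H) y = ∑ᶠ h : H, ρ h y := by
  have := Fintype.ofFinite H
  simp [subgroupSum, finsum_eq_sum_of_fintype]

theorem apply_asAlgebraHom_subgroupSum {h : G} (hh : h ∈ H) (y : M) :
    ρ h (ρ.asAlgebraHom (subgroupSum k H) y) = ρ.asAlgebraHom (subgroupSum k H) y := by
  rw [← ρ.asAlgebraHom_of, ← Module.End.mul_apply, ← map_mul, of_mul_subgroupSum hh]

theorem asAlgebraHom_subgroupSum_comm {g : G} (hg : g ∈ Subgroup.normalizer (H : Set G)) (y : M) :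
    ρ.asAlgebraHom (subgroupSum k H) (ρ g y) = ρ g (ρ.asAlgebraHom (subgroupSum k H) y) := by
  simp only [← ρ.asAlgebraHom_of, ← Module.End.mul_apply, ← map_mul,
    (commute_of_subgroupSum hg).eq]

theorem asAlgebraHom_subgroupSum_subgroupAlgHom_comm {L : Subgroup G}
    (hL : L ≤ Subgroup.normalizer (H : Set G)) (a : k[L]) (y : M) :
    ρ.asAlgebraHom (subgroupSum k H) (ρ.asAlgebraHom (subgroupAlgHom k L a) y) =
      ρ.asAlgebraHom (subgroupAlgHom k L a) (ρ.asAlgebraHom (subgroupSum k H) y) := by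
  induction a using MonoidAlgebra.induction_on with
  | of l =>
    rw [subgroupAlgHom_of, ρ.asAlgebraHom_of]
    exact asAlgebraHom_subgroupSum_comm (hL l.2) y
  | add a b ha hb => simp only [map_add, LinearMap.add_apply, ha, hb]
  | smul c a ha => simp only [map_smul, LinearMap.smul_apply, ha]

theorem asAlgebraHom_subgroupSum_apply_of_mem {h : G} (hh : h ∈ H) (y : M) :
    ρ.asAlgebraHom (subgroupSum k H) (ρ h y) = ρ.asAlgebraHom (subgroupSum k H) y := by
  rw [← ρ.asAlgebraHom_of, ← Module.End.mul_apply, ← map_mul, subgroupSum_mul_of hh]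

theorem asAlgebraHom_subgroupSum_of_forall_mem {y : M} (hy : ∀ h ∈ H, ρ h y = y) :
    ρ.asAlgebraHom (subgroupSum k H) y = (Nat.card H : k) • y := by
  have := Fintype.ofFinite H
  rw [asAlgebraHom_subgroupSum_apply, finsum_congr fun h : H => hy h h.2, finsum_eq_sum_of_fintype]
  simp [Nat.cast_smul_eq_nsmul]

end SubgroupSum

theorem natCard_ne_zero_of_isPGroup {p : ℕ} [Fact p.Prime] {R : Type*} [Semiring R]
    [NoZeroDivisors R] (hp : (p : R) ≠ 0) {H : Type*} [Group H] [Finite H] (hH : IsPGroup p H) :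
    (Nat.card H : R) ≠ 0 := by
  obtain ⟨m, hm⟩ := IsPGroup.iff_card.1 hH
  rw [hm, Nat.cast_pow]
  exact pow_ne_zero m hp

section HarishChandraRestriction

/-- The unipotent radical `U_P = O_p(P)` of a parabolic subgroup `P`, as a subgroup of `G`. -/
def unipotentRadical (p : ℕ) {G : Type*} [Group G] (P : Subgroup G) : Subgroup G :=
  (pCore p P).map P.subtype

theorem mem_invariants_iff {p : ℕ} {k : Type*} [CommRing k] {G : Type*} [Group G]
    {P : Subgroup G} {M : Type*} [AddCommGroup M] [Module k M] {ρ : Representation k G M} {y : M} :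
    y ∈ Representation.invariants
      ((ρ.comp P.subtype : Representation k P M).comp (pCore p P).subtype) ↔
    ∀ u ∈ unipotentRadical p P, ρ u y = y := by
  simp [unipotentRadical, Representation.mem_invariants]

variable {p : ℕ} {k : Type*} [Field k] {G : Type*} [Group G] {P L : Subgroup G}

theorem unipotentRadical_le : unipotentRadical p P ≤ P := Subgroup.map_subtype_le _

theorem le_normalizer_unipotentRadical :
    P ≤ Subgroup.normalizer (unipotentRadical p P : Set G) := by
  refine (Subgroup.normal_subgroupOf_iff_le_normalizer unipotentRadical_le).1 ?_
  rw [unipotentRadical, Subgroup.subgroupOf,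
    Subgroup.comap_map_eq_self_of_injective P.subtype_injective]
  exact pCore_normal p P

theorem isPGroup_unipotentRadical [Fact p.Prime] [Finite G] :
    IsPGroup p (unipotentRadical p P) :=
  (pCore_isPGroup p P).map P.subtype

variable {M : Type*} [AddCommGroup M] [Module k M] {ρ : Representation k G M}

/-- The annihilator in `kL` of the `kL`-module `*R_L^G(M) = M^{U_P}`. -/
noncomputable def hcAnnihilator (h : IsLeviComplement p P L) (ρ : Representation k G M) :
    Ideal k[L] :=
  RingHom.ker (hcRes h ρ).asAlgebraHom

variable (h : IsLeviComplement p P L)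

theorem coe_asAlgebraHom_hcRes (a : k[L]) (y) :
    ((hcRes h ρ).asAlgebraHom a y : M) = ρ.asAlgebraHom (subgroupAlgHom k L a) y := by
  induction a using MonoidAlgebra.induction_on with
  | of l =>
    rw [subgroupAlgHom_of, Representation.asAlgebraHom_of, Representation.asAlgebraHom_of]
    rfl
  | add a b ha hb => simp only [map_add, LinearMap.add_apply, Submodule.coe_add, ha, hb]
  | smul c a ha => simp only [map_smul, LinearMap.smul_apply, Submodule.coe_smul, ha]

theorem mem_hcAnnihilator_iff {a : k[L]} : a ∈ hcAnnihilator h ρ ↔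
    ∀ y, (∀ u ∈ unipotentRadical p P, ρ u y = y) →
      ρ.asAlgebraHom (subgroupAlgHom k L a) y = 0 := by
  simp only [hcAnnihilator, RingHom.mem_ker, ← mem_invariants_iff, LinearMap.ext_iff,
    Subtype.ext_iff, Subtype.forall, coe_asAlgebraHom_hcRes, LinearMap.zero_apply,
    Submodule.coe_zero]

include h in
theorem apply_asAlgebraHom_of_forall_mem {y : M} (hy : ∀ u ∈ unipotentRadical p P, ρ u y = y)
    (a : k[L]) {u : G} (hu : u ∈ unipotentRadical p P) :
    ρ u (ρ.asAlgebraHom (subgroupAlgHom k L a) y) = ρ.asAlgebraHom (subgroupAlgHom k L a) y := by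
  rw [← coe_asAlgebraHom_hcRes h a ⟨y, mem_invariants_iff.2 hy⟩]
  exact mem_invariants_iff.1 (Subtype.prop _) u hu

variable [Fact p.Prime] [Finite G] (hp : (p : k) ≠ 0)
include hp

theorem mem_hcAnnihilator_iff_mul_subgroupSum {a : k[L]} : a ∈ hcAnnihilator h ρ ↔
    subgroupAlgHom k L a * subgroupSum k (unipotentRadical p P) ∈ RingHom.ker ρ.asAlgebraHom := by
  rw [mem_hcAnnihilator_iff, RingHom.mem_ker, LinearMap.ext_iff]
  simp only [map_mul, Module.End.mul_apply, LinearMap.zero_apply]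
  refine ⟨fun ha y => ha _ fun u hu => apply_asAlgebraHom_subgroupSum hu y, fun ha y hy => ?_⟩
  have hcard := natCard_ne_zero_of_isPGroup hp (isPGroup_unipotentRadical (P := P))
  refine (smul_eq_zero_iff_right hcard).1 ?_
  rw [← map_smul, ← asAlgebraHom_subgroupSum_of_forall_mem hy, ha]

theorem hcAnnihilator_mono {M' : Type*} [AddCommGroup M'] [Module k M']
    {ρ' : Representation k G M'}
    (hρ : RingHom.ker ρ.asAlgebraHom ≤ RingHom.ker ρ'.asAlgebraHom) :
    hcAnnihilator h ρ ≤ hcAnnihilator h ρ' := by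
  intro a ha
  rw [mem_hcAnnihilator_iff_mul_subgroupSum h hp] at ha ⊢
  exact hρ ha

end HarishChandraRestriction

namespace BNPair

variable {G : Type*} [Group G] (D : BNPair G)

theorem N_le_normalizer_T : D.N ≤ Subgroup.normalizer (D.T : Set G) :=
  Subgroup.le_normalizer_of_normal_subgroupOf inf_le_right

/-- The action of `N` on the group algebra `kT` by conjugation. -/
noncomputable def torusConj (k : Type*) [CommRing k] : D.N →* (k[D.T] ≃ₐ[k] k[D.T]) :=
  (MonoidAlgebra.domCongrAut (R := k)).comp
    (D.T.normalizerMonoidHom.comp (Subgroup.inclusion D.N_le_normalizer_T))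

variable {k : Type*} [CommRing k]

theorem torusConj_of (n : D.N) (t : D.T) : D.torusConj k n (MonoidAlgebra.of k D.T t) =
    MonoidAlgebra.of k D.T
      ⟨n * t * (n : G)⁻¹, (Subgroup.mem_normalizer_iff.1 (D.N_le_normalizer_T n.2) t).1 t.2⟩ := by
  exact MonoidAlgebra.domCongr_single ..

theorem apply_asAlgebraHom_subgroupAlgHom {M : Type*} [AddCommGroup M] [Module k M]
    (ρ : Representation k G M) (n : D.N) (a : k[D.T]) (y : M) :
    ρ n (ρ.asAlgebraHom (subgroupAlgHom k D.T a) y) =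
      ρ.asAlgebraHom (subgroupAlgHom k D.T (D.torusConj k n a)) (ρ n y) := by
  induction a using MonoidAlgebra.induction_on with
  | of t =>
    simp only [torusConj_of, subgroupAlgHom_of, Representation.asAlgebraHom_of,
      ← Module.End.mul_apply, ← map_mul, inv_mul_cancel_right]
  | add a b ha hb => simp only [map_add, LinearMap.add_apply, ha, hb]
  | smul c a ha => simp only [map_smul, LinearMap.smul_apply, ha]

end BNPair

section LeviProjection

variable {p : ℕ} {G : Type*} [Group G] {P L : Subgroup G} (h : IsLeviComplement p P L)

include h in
theorem IsLeviComplement.exists_eq_mul {g : G} (hg : g ∈ P) :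
    ∃ l ∈ L, ∃ u ∈ unipotentRadical p P, g = l * u := by
  obtain ⟨⟨l, u⟩, hlu⟩ := h.compl.2 ⟨g, hg⟩
  exact ⟨l, l.2, u, Subgroup.mem_map_of_mem _ u.2, congrArg Subtype.val hlu.symm⟩

theorem leviProj_eq_one_iff (g : P) : leviProj h g = 1 ↔ (g : G) ∈ unipotentRadical p P := by
  simp only [leviProj, unipotentRadical, MonoidHom.comp_apply, MulEquiv.toMonoidHom_eq_coe,
    MonoidHom.coe_coe, EmbeddingLike.map_eq_one_iff, QuotientGroup.mk'_apply,
    QuotientGroup.eq_one_iff]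
  simp

theorem leviProj_of_mem (g : P) (hg : (g : G) ∈ L) : leviProj h g = ⟨g, hg⟩ := by
  have hquot : h.compl.QuotientMulEquiv (QuotientGroup.mk' _ g) = ⟨g, hg⟩ :=
    (Equiv.symm_apply_eq _).2 rfl
  simp only [leviProj, MonoidHom.comp_apply, MulEquiv.toMonoidHom_eq_coe, MonoidHom.coe_coe, hquot]
  rfl

end LeviProjection

theorem mul_mul_mem_doubleCoset {G : Type*} [Group G] {H K : Subgroup G} {a x h k : G}
    (hh : h ∈ H) (hx : x ∈ DoubleCoset.doubleCoset a H K) (hk : k ∈ K) :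
    h * x * k ∈ DoubleCoset.doubleCoset a H K := by
  obtain ⟨h', hh', k', hk', rfl⟩ := DoubleCoset.mem_doubleCoset.1 hx
  exact DoubleCoset.mem_doubleCoset.2
    ⟨h * h', mul_mem hh hh', k' * k, mul_mem hk' hk, by simp only [mul_assoc]⟩

namespace BNPair

variable {G : Type*} [Group G] (D : BNPair G)

theorem inv_mem_S {s : D.W} (hs : s ∈ D.S) : s⁻¹ ∈ D.S := by
  rwa [inv_eq_of_mul_eq_one_left (D.sq_eq_one s hs)]

theorem submonoidClosure_S : Submonoid.closure D.S = ⊤ := by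
  have hinv : D.S⁻¹ ⊆ D.S := fun s hs => inv_inv s ▸ D.inv_mem_S hs
  rw [← Set.union_eq_left.2 hinv, ← Subgroup.closure_toSubmonoid, D.closure_S]
  rfl

theorem N_induction {motive : D.N → Prop} (torus : ∀ t : D.N, (t : G) ∈ D.T → motive t)
    (reflection : ∀ n : D.N, (n : D.W) ∈ D.S → motive n)
    (mul : ∀ n m, motive n → motive m → motive (n * m)) (n : D.N) : motive n := by
  suffices ∀ w : D.W, ∀ n : D.N, (n : D.W) = w → motive n from this _ n rfl
  intro w
  induction (D.submonoidClosure_S ▸ Submonoid.mem_top w : w ∈ Submonoid.closure D.S)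
    using Submonoid.closure_induction with
  | mem s hs => rintro n rfl; exact reflection n hs
  | one => exact fun n hn => torus n ((QuotientGroup.eq_one_iff n).1 hn)
  | mul a b _ _ ha hb =>
    intro n hn
    obtain ⟨m, rfl⟩ := QuotientGroup.mk_surjective a
    simpa using mul m (m⁻¹ * n) (ha m rfl) (hb _ (by simp [hn]))

theorem mul_mem_doubleCoset {b n x : G} (hb : b ∈ D.B)
    (hx : x ∈ DoubleCoset.doubleCoset n D.B D.B) :
    b * x ∈ DoubleCoset.doubleCoset n D.B D.B :=
  mul_one (b * x) ▸ mul_mul_mem_doubleCoset hb hx (one_mem _)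

theorem exists_mul_mem_doubleCoset (n m : D.N) {x : G}
    (hx : x ∈ DoubleCoset.doubleCoset (m : G) D.B D.B) :
    ∃ m' : D.N, n * x ∈ DoubleCoset.doubleCoset (m' : G) D.B D.B := by
  induction n using D.N_induction generalizing m x with
  | torus t ht => exact ⟨m, D.mul_mem_doubleCoset ht.1 hx⟩
  | reflection n hn =>
    obtain ⟨b₁, hb₁, b₂, hb₂, rfl⟩ := DoubleCoset.mem_doubleCoset.1 hx
    obtain ⟨m', h⟩ : ∃ m' : D.N, n * b₁ * m ∈ DoubleCoset.doubleCoset (m' : G) D.B D.B :=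
      (D.exchange n m hn b₁ hb₁).elim (fun h => ⟨n * m, h⟩) fun h => ⟨m, h⟩
    exact ⟨m', by simpa [mul_assoc] using mul_mul_mem_doubleCoset (one_mem _) h hb₂⟩
  | mul n₁ n₂ h₁ h₂ =>
    obtain ⟨m', h⟩ := h₂ m hx
    simpa only [Subgroup.coe_mul, mul_assoc] using h₁ m' h

theorem bruhat (g : G) : ∃ n : D.N, g ∈ DoubleCoset.doubleCoset (n : G) D.B D.B := by
  have hg : g ∈ Subgroup.closure ((D.B : Set G) ∪ D.N) := by
    rw [← Subgroup.sup_eq_closure, D.generate]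
    trivial
  induction hg using Subgroup.closure_induction_left with
  | one => exact ⟨1, DoubleCoset.mem_doubleCoset_self D.B D.B 1⟩
  | mul_left x hx y _ ih =>
    obtain ⟨n, hn⟩ := ih
    exact hx.elim (fun hx => ⟨n, D.mul_mem_doubleCoset hx hn⟩)
      fun hx => D.exists_mul_mem_doubleCoset ⟨x, hx⟩ n hn
  | inv_mul_cancel x hx y _ ih =>
    obtain ⟨n, hn⟩ := ih
    exact hx.elim (fun hx => ⟨n, D.mul_mem_doubleCoset (inv_mem hx) hn⟩)
      fun hx => D.exists_mul_mem_doubleCoset ⟨x, hx⟩⁻¹ n hn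

theorem conj_mem_doubleCoset_of_notMem {n : D.N} (hn : (n : D.W) ∈ D.S) {b : G} (hb : b ∈ D.B)
    (h : n * b * (n : G)⁻¹ ∉ D.B) :
    n * b * (n : G)⁻¹ ∈ DoubleCoset.doubleCoset (n : G)⁻¹ D.B D.B := by
  refine (D.exchange n n⁻¹ hn b hb).resolve_left fun hmem => h ?_
  obtain ⟨b₁, hb₁, b₂, hb₂, heq⟩ := DoubleCoset.mem_doubleCoset.1 hmem
  rw [Subgroup.coe_inv, mul_inv_cancel, mul_one] at heq
  exact heq ▸ mul_mem hb₁ hb₂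

end BNPair

namespace SplitBNPair

variable {p : ℕ} {G : Type*} [Group G] (D : SplitBNPair p G)

instance : IsMulCommutative D.T := ⟨⟨fun s t => Subtype.ext (D.comm s s.2 t t.2)⟩⟩

/-- The unipotent radical `U = O_p(B)` of the Borel subgroup, as a subgroup of `G`. -/
abbrev U : Subgroup G := unipotentRadical p D.B

theorem T_le_normalizer_U : D.T ≤ Subgroup.normalizer (D.U : Set G) :=
  inf_le_left.trans le_normalizer_unipotentRadical

theorem torusConj_of_mem_T {k : Type*} [CommRing k] {n : D.N} (hn : (n : G) ∈ D.T) (a : k[D.T]) :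
    D.torusConj k n a = a := by
  induction a using MonoidAlgebra.induction_on with
  | of t =>
    rw [BNPair.torusConj_of]
    congr
    rw [D.comm n hn t t.2, mul_inv_cancel_right]
  | add a b ha hb => rw [map_add, ha, hb]
  | smul c a ha => rw [map_smul, ha]

variable [Fact p.Prime] [Finite G]

theorem mem_U_of_pow_eq_one {b : G} (hb : b ∈ D.B) {m : ℕ} (hm : b ^ p ^ m = 1) : b ∈ D.U := by
  refine (leviProj_eq_one_iff D.isLeviComplement ⟨b, hb⟩).1 (orderOf_eq_one_iff.1 ?_)
  refine Nat.eq_one_of_dvd_coprimes (D.coprime.pow_right m) (orderOf_dvd_natCard _)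
    (orderOf_dvd_of_pow_eq_one ?_)
  rw [← map_pow, (Subtype.ext hm : (⟨b, hb⟩ : D.B) ^ p ^ m = 1), map_one]

theorem conj_mem_U_of_mem_B {n u : G} (hu : u ∈ D.U) (h : n * u * n⁻¹ ∈ D.B) :
    n * u * n⁻¹ ∈ D.U := by
  obtain ⟨m, hm⟩ := isPGroup_unipotentRadical ⟨u, hu⟩
  have hum : u ^ p ^ m = 1 := congrArg Subtype.val hm
  exact D.mem_U_of_pow_eq_one h (m := m) (by rw [conj_pow, hum, mul_one, mul_inv_cancel])

variable {k : Type*} [Field k] {M : Type*} [AddCommGroup M] [Module k M]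
  {ρ : Representation k G M}

theorem subgroupSum_eq_zero_of_mem_doubleCoset {y : M} (hy : ∀ u ∈ D.U, ρ u y = y) {n g : G}
    (hn : n ∈ D.N) (hny : ρ.asAlgebraHom (subgroupSum k D.U) (ρ n y) = 0)
    (hg : g ∈ DoubleCoset.doubleCoset n D.B D.B) :
    ρ.asAlgebraHom (subgroupSum k D.U) (ρ g y) = 0 := by
  obtain ⟨b, hb, c, hc, rfl⟩ := DoubleCoset.mem_doubleCoset.1 hg
  obtain ⟨t, ht, u, hu, rfl⟩ := D.isLeviComplement.exists_eq_mul hc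
  have hnt : b * (n * t * n⁻¹) ∈ D.B :=
    mul_mem hb ((Subgroup.mem_normalizer_iff.1 (D.N_le_normalizer_T hn) t).1 ht).1
  have hmul : b * n * (t * u) = b * (n * t * n⁻¹) * n * u := by group
  rw [hmul, map_mul, map_mul, Module.End.mul_apply, Module.End.mul_apply, hy u hu,
    asAlgebraHom_subgroupSum_comm (le_normalizer_unipotentRadical hnt), hny, map_zero]

variable (hp : (p : k) ≠ 0)
include hp

theorem eq_zero_of_subgroupSum_reflection_eq_zero {n : D.N} (hn : (n : D.W) ∈ D.S) {y : M}
    (hy : ∀ u ∈ D.U, ρ u y = y)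
    (hny : ρ.asAlgebraHom (subgroupSum k D.U) (ρ (n : G)⁻¹ y) = 0) : y = 0 := by
  classical
  let := Fintype.ofFinite D.U
  let K : Subgroup D.U := (D.U.comap (MulAut.conj (n : G)).toMonoidHom).subgroupOf D.U
  -- `n u n⁻¹` either lies in `U` and fixes `y`, or lies in `B n⁻¹ B` and is killed with `y`.
  have hterm (u : D.U) : ρ.asAlgebraHom (subgroupSum k D.U) (ρ (n * u * (n : G)⁻¹) y) =
      if u ∈ K then (Nat.card D.U : k) • y else 0 := by
    split_ifs with hu
    · rw [hy (n * u * (n : G)⁻¹) hu, asAlgebraHom_subgroupSum_of_forall_mem hy]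
    · have hB : n * (u : G) * (n : G)⁻¹ ∉ D.B := fun h => hu (D.conj_mem_U_of_mem_B u.2 h)
      exact D.subgroupSum_eq_zero_of_mem_doubleCoset hy (inv_mem n.2) hny
        (D.conj_mem_doubleCoset_of_notMem hn (unipotentRadical_le u.2) hB)
  have hsum : (Nat.card K : k) • (Nat.card D.U : k) • y = 0 :=
    calc (Nat.card K : k) • (Nat.card D.U : k) • y
      _ = ∑ u : D.U, if u ∈ K then (Nat.card D.U : k) • y else 0 := by
        rw [← Finset.sum_filter, Finset.sum_const, ← Fintype.card_subtype,
          ← Nat.card_eq_fintype_card, Nat.cast_smul_eq_nsmul]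
      _ = ρ.asAlgebraHom (subgroupSum k D.U)
          (ρ n (ρ.asAlgebraHom (subgroupSum k D.U) (ρ (n : G)⁻¹ y))) := by
        rw [asAlgebraHom_subgroupSum_apply (ρ (n : G)⁻¹ y), finsum_eq_sum_of_fintype, map_sum,
          map_sum]
        simp only [← hterm, map_mul, Module.End.mul_apply]
      _ = 0 := by rw [hny, map_zero, map_zero]
  have hU : IsPGroup p D.U := isPGroup_unipotentRadical
  rwa [smul_eq_zero_iff_right (natCard_ne_zero_of_isPGroup hp (hU.to_subgroup K)),
    smul_eq_zero_iff_right (natCard_ne_zero_of_isPGroup hp hU)] at hsum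

theorem torusConj_mem_hcAnnihilator (n : D.N) {a : k[D.T]}
    (ha : a ∈ hcAnnihilator D.isLeviComplement ρ) :
    D.torusConj k n a ∈ hcAnnihilator D.isLeviComplement ρ := by
  induction n using D.N_induction generalizing a with
  | torus t ht => rwa [D.torusConj_of_mem_T ht]
  | mul n m hn hm =>
    rw [map_mul, AlgEquiv.mul_apply]
    exact hn (hm ha)
  | reflection n hn =>
    rw [mem_hcAnnihilator_iff] at ha ⊢
    intro y hy
    refine D.eq_zero_of_subgroupSum_reflection_eq_zero hp hn
      (fun u => apply_asAlgebraHom_of_forall_mem D.isLeviComplement hy _) ?_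
    have hconj : ρ (n : G)⁻¹ (ρ.asAlgebraHom (subgroupAlgHom k D.T (D.torusConj k n a)) y) =
        ρ.asAlgebraHom (subgroupAlgHom k D.T a) (ρ (n : G)⁻¹ y) := by
      simpa using D.apply_asAlgebraHom_subgroupAlgHom ρ n⁻¹ (D.torusConj k n a) y
    rw [hconj, asAlgebraHom_subgroupSum_subgroupAlgHom_comm D.T_le_normalizer_U]
    exact ha _ fun u hu => apply_asAlgebraHom_subgroupSum hu _

end SplitBNPair

section HarishChandraInduction

theorem indV_mk_mul {k : Type*} [CommRing k] {H G : Type*} [Group H] [Group G] (φ : H →* G)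
    {X : Type*} [AddCommGroup X] [Module k X] (σ : Representation k H X) (h : H) (g : G) (x : X) :
    Representation.IndV.mk φ σ (φ h * g) x = Representation.IndV.mk φ σ g (σ h⁻¹ x) := by
  simp

variable {p : ℕ} {k : Type*} [Field k] {G : Type*} [Group G] {P L : Subgroup G}
  (h : IsLeviComplement p P L) {X : Type*} [AddCommGroup X] [Module k X] (τ : Representation k L X)

/-- The map `x ↦ g⁻¹ ⊗ x` from `X` to `R_L^G(X) = kG ⊗_{kP} X`. -/
noncomputable abbrev hcIndMk (g : G) :
    X →ₗ[k] Representation.IndV P.subtype (τ.comp (leviProj h)) :=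
  Representation.IndV.mk P.subtype (τ.comp (leviProj h)) g

theorem hcInd_apply_hcIndMk (g g' : G) (x : X) :
    hcInd h τ g (hcIndMk h τ g' x) = hcIndMk h τ (g' * g⁻¹) x :=
  Representation.ind_mk ..

theorem hcIndMk_mul {b : G} (hb : b ∈ P) (g : G) (x : X) :
    hcIndMk h τ (b * g) x = hcIndMk h τ g (τ (leviProj h ⟨b, hb⟩)⁻¹ x) := by
  rw [← map_inv]
  exact indV_mk_mul P.subtype (τ.comp (leviProj h)) ⟨b, hb⟩ g x

theorem hcIndMk_inv_mul (l : L) (g : G) (x : X) :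
    hcIndMk h τ ((l : G)⁻¹ * g) x = hcIndMk h τ g (τ l x) := by
  rw [← L.coe_inv, hcIndMk_mul h τ (h.le l⁻¹.2), leviProj_of_mem h _ l⁻¹.2, inv_inv]

end HarishChandraInduction

namespace SplitBNPair

variable {p : ℕ} [Fact p.Prime] {G : Type*} [Group G] [Finite G] (D : SplitBNPair p G)
  {k : Type*} [Field k] {X : Type*} [AddCommGroup X] [Module k X] (τ : Representation k D.T X)

theorem asAlgebraHom_hcInd_hcIndMk (n : D.N) (a : k[D.T]) (x : X) :
    (hcInd D.isLeviComplement τ).asAlgebraHom (subgroupAlgHom k D.T a)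
        (hcIndMk D.isLeviComplement τ n x) =
      hcIndMk D.isLeviComplement τ n (τ.asAlgebraHom (D.torusConj k n a) x) := by
  induction a using MonoidAlgebra.induction_on with
  | of t =>
    rw [BNPair.torusConj_of, τ.asAlgebraHom_of, ← hcIndMk_inv_mul, subgroupAlgHom_of,
      Representation.asAlgebraHom_of, hcInd_apply_hcIndMk]
    congr 2
    group
  | add a b ha hb => simp only [map_add, LinearMap.add_apply, ha, hb]
  | smul c a ha => simp only [map_smul, LinearMap.smul_apply, ha]

theorem exists_eq_mul_mul (g : G) : ∃ b ∈ D.B, ∃ n : D.N, ∃ u ∈ D.U, g = b * n * u := by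
  obtain ⟨n, hn⟩ := D.bruhat g
  obtain ⟨b, hb, c, hc, rfl⟩ := DoubleCoset.mem_doubleCoset.1 hn
  obtain ⟨t, ht, u, hu, rfl⟩ := D.isLeviComplement.exists_eq_mul hc
  exact ⟨b, hb, n * ⟨t, ht.2⟩, u, hu, by simp only [Subgroup.coe_mul, mul_assoc]⟩

theorem iInf_comap_torusConj_le_hcAnnihilator (hp : (p : k) ≠ 0) :
    ⨅ n : D.N, (RingHom.ker τ.asAlgebraHom).comap (D.torusConj k n) ≤
      hcAnnihilator D.isLeviComplement (hcInd D.isLeviComplement τ) := by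
  intro a ha
  have hτ (n : D.N) : τ.asAlgebraHom (D.torusConj k n a) = 0 := Ideal.mem_iInf.1 ha n
  rw [mem_hcAnnihilator_iff_mul_subgroupSum D.isLeviComplement hp, RingHom.mem_ker]
  refine Representation.IndV.hom_ext _ _ fun g => LinearMap.ext fun x => ?_
  obtain ⟨b, hb, n, u, hu, rfl⟩ := D.exists_eq_mul_mul g
  have hmk : hcIndMk D.isLeviComplement τ (b * n * u) x =
      hcInd D.isLeviComplement τ u⁻¹ (hcIndMk D.isLeviComplement τ n
        (τ (leviProj D.isLeviComplement ⟨b, hb⟩)⁻¹ x)) := by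
    rw [mul_assoc, hcIndMk_mul _ _ hb, hcInd_apply_hcIndMk, inv_inv]
  change (hcInd D.isLeviComplement τ).asAlgebraHom _ (hcIndMk D.isLeviComplement τ _ x) = 0
  rw [hmk, map_mul, Module.End.mul_apply, asAlgebraHom_subgroupSum_apply_of_mem (inv_mem hu),
    ← asAlgebraHom_subgroupSum_subgroupAlgHom_comm D.T_le_normalizer_U,
    asAlgebraHom_hcInd_hcIndMk, hτ, LinearMap.zero_apply, map_zero, map_zero]

variable {p : ℕ} [Fact p.Prime] {G : Type v} [Group G] [Finite G] (D : SplitBNPair p G)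
  {k : Type u} [Field k] {X X' : Type*} [AddCommGroup X] [Module k X] [AddCommGroup X']
  [Module k X'] {τ : Representation k D.T X} {τ' : Representation k D.T X'}

theorem compositionMultiplicity_hcRes_ne_zero_iff (hτ : τ.IsIrreducible) {M : Type*}
    [AddCommGroup M] [Module k M] {ρ : Representation k G M} (hρ : ρ.IsIrreducible) :
    compositionMultiplicity (hcRes D.isLeviComplement ρ) τ ≠ 0 ↔
      hcAnnihilator D.isLeviComplement ρ ≤ RingHom.ker τ.asAlgebraHom := by
  have := finiteDimensional_of_isIrreducible hρ
  exact compositionMultiplicity_ne_zero_iff_ker_le hτ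

theorem hcAnnihilator_le_comap_torusConj_iff (hp : (p : k) ≠ 0) {M : Type*} [AddCommGroup M]
    [Module k M] {ρ : Representation k G M} (n : D.N) (I : Ideal k[D.T]) :
    hcAnnihilator D.isLeviComplement ρ ≤ I.comap (D.torusConj k n) ↔
      hcAnnihilator D.isLeviComplement ρ ≤ I := by
  refine ⟨fun h a ha => ?_, fun h a ha => h (D.torusConj_mem_hcAnnihilator hp n ha)⟩
  simpa using h (D.torusConj_mem_hcAnnihilator hp n⁻¹ ha)

theorem principalSeries_eq_of_comap_torusConj_eq (hp : (p : k) ≠ 0) (hτ : τ.IsIrreducible)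
    (hτ' : τ'.IsIrreducible) {n : D.N}
    (hn : (RingHom.ker τ.asAlgebraHom).comap (D.torusConj k n) = RingHom.ker τ'.asAlgebraHom) :
    (principalSeries D τ : Set (Rep.{w} k G)) = principalSeries D τ' := by
  refine Set.ext fun Y => and_congr_right fun hY => and_congr_right' <| and_congr_right' ?_
  rw [D.compositionMultiplicity_hcRes_ne_zero_iff hτ hY,
    D.compositionMultiplicity_hcRes_ne_zero_iff hτ' hY, ← hn,
    D.hcAnnihilator_le_comap_torusConj_iff hp]

open scoped IsMulCommutative in
theorem exists_comap_torusConj_eq (hp : (p : k) ≠ 0) (hτ : τ.IsIrreducible)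
    (hτ' : τ'.IsIrreducible) {M : Type*} [AddCommGroup M] [Module k M] {ρ : Representation k G M}
    (hρ : hcAnnihilator D.isLeviComplement ρ ≤ RingHom.ker τ'.asAlgebraHom)
    (hmult : compositionMultiplicity (hcInd D.isLeviComplement τ) ρ ≠ 0) :
    ∃ n : D.N,
      (RingHom.ker τ.asAlgebraHom).comap (D.torusConj k n) = RingHom.ker τ'.asAlgebraHom := by
  have hle : ⨅ n : D.N, (RingHom.ker τ.asAlgebraHom).comap (D.torusConj k n) ≤
      RingHom.ker τ'.asAlgebraHom :=
    calc ⨅ n : D.N, (RingHom.ker τ.asAlgebraHom).comap (D.torusConj k n)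
      _ ≤ hcAnnihilator D.isLeviComplement (hcInd D.isLeviComplement τ) :=
        D.iInf_comap_torusConj_le_hcAnnihilator τ hp
      _ ≤ hcAnnihilator D.isLeviComplement ρ := hcAnnihilator_mono _ hp
        (ker_asAlgebraHom_le_of_compositionMultiplicity_ne_zero hmult)
      _ ≤ RingHom.ker τ'.asAlgebraHom := hρ
  have hmax := isMaximal_ker_asAlgebraHom hτ
  have hmax' := isMaximal_ker_asAlgebraHom hτ'
  have := Fintype.ofFinite D.N
  rw [← Finset.inf_univ_eq_iInf] at hle
  obtain ⟨n, -, hn⟩ := hmax'.isPrime.inf_le'.1 hle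
  exact ⟨n, (Ideal.comap_isMaximal_of_equiv (D.torusConj k n)).eq_of_le hmax'.ne_top hn⟩

end SplitBNPair

end HarishChandra

theorem proposition4p2_general {p : ℕ} [Fact p.Prime] {k : Type u} [Field k] (hp : (p : k) ≠ 0)
    {G : Type v} [Group G] [Finite G] (D : HarishChandra.SplitBNPair p G)
    {X X' : Type*} [AddCommGroup X] [Module k X] [AddCommGroup X'] [Module k X']
    (τ : Representation k D.T X) (τ' : Representation k D.T X')
    (hτ : τ.IsIrreducible) (hτ' : τ'.IsIrreducible)
    (V : Rep.{w} k G) (hV : V ∈ HarishChandra.principalSeries D τ')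
    (hne : (HarishChandra.principalSeries D τ : Set (Rep.{w} k G)) ≠
      HarishChandra.principalSeries D τ') :
    HarishChandra.compositionMultiplicity
      (HarishChandra.hcInd D.isLeviComplement τ) V.ρ = 0 := by
  by_contra hmult
  obtain ⟨hVirr, -, -, hVτ'⟩ := hV
  have hle := (D.compositionMultiplicity_hcRes_ne_zero_iff hτ' hVirr).1 hVτ'
  obtain ⟨n, hn⟩ := D.exists_comap_torusConj_eq hp hτ hτ' hle hmult
  exact hne (D.principalSeries_eq_of_comap_torusConj_eq hp hτ hτ' hn)

theorem proposition4p2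
    {p r : ℕ} [Fact p.Prime] (hr : 0 < r) (hrp : r ≠ p)
    {k : Type u} [Field k] [IsAlgClosed k] [CharP k r]
    {G : Type v} [Group G] [Finite G] (D : HarishChandra.SplitBNPair p G)
    {X X' : Type*} [AddCommGroup X] [Module k X] [AddCommGroup X'] [Module k X']
    (τ : Representation k D.T X) (τ' : Representation k D.T X')
    (hτ : τ.IsIrreducible) (hτ' : τ'.IsIrreducible)
    (Y V : Rep.{w} k G)
    (hY : Y ∈ HarishChandra.principalSeries D τ)
    (hV : V ∈ HarishChandra.principalSeries D τ')
    (hne : (HarishChandra.principalSeries D τ : Set (Rep.{w} k G)) ≠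
      HarishChandra.principalSeries D τ') :
    HarishChandra.compositionMultiplicity
      (HarishChandra.hcInd D.isLeviComplement τ) V.ρ = 0 :=
  proposition4p2_general (CharP.cast_ne_zero_of_ne_of_prime k (Fact.out : p.Prime) hrp)
    D τ τ' hτ hτ' V hV hne
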